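/- Consider a finite game with a finite set of players $\mathcal N$. Player $i$ has the actions $\mathcal A_i=\{0,1,\dots,m_i\}$ and a payoff function $u_i:\mathcal A=\prod_j\mathcal A_j\to\mathbb R$. Let $\mathcal X=\prod_i\Delta(\mathcal A_i)$ be the space of mixed strategy profiles and $\mathcal X^\circ$ its relative interior (all $x_{ia}>0$). Write $u_i(x)=\sum_{\alpha\in\mathcal A}u_i(\alpha)\prod_j x_{j\alpha_j}$ for the mixed payoffs and $v_{ia}(x)=u_i(a;x_{-i})$ for the payoff of the pure action $a$ of player $i$ against $x_{-i}$. The game is called harmonic if $$\sum_{i\in\mathcal N}\sum_{\beta_i\in\mathcal A_i}\bigl[u_i(\beta_i;\alpha_{-i})-u_i(\alpha)\bigr]=0\qquad\text{for all }\alpha\in\mathcal A.$$ The exponential-weights dynamics are $$y_{ia}(t)=y_{ia}(0)+\int_0^t v_{ia}(x(s))\,ds,\qquad x_{ia}(t)=\frac{e^{y_{ia}(t)}}{\sum_{b\in\mathcal A_i}e^{y_{ib}(t)}}\qquad(t\ge 0),$$ and the replicator dynamics are $$\dot x_{ia}=x_{ia}\bigl[v_{ia}(x)-u_i(x)\bigr]\qquad(t\ge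 0,\ x(t)\in\mathcal X).$$ Theorem. Suppose that the game is harmonic. Then the exponential-weights and replicator dynamics are Poincaré recurrent. Precisely: from every $x_0\in\mathcal X^\circ$ there is a replicator trajectory defined for all $t\ge0$, from every initial score profile $y(0)$ there is an exponential-weights trajectory defined for all $t\ge 0$, and for almost every $x_0\in\mathcal X^\circ$, every trajectory $x(t)$ of either dynamics with $x(0)=x_0$ returns to its starting point: there is an increasing sequence of times $t_n\ge 0$ with $t_n\uparrow\infty$ and $x(t_n)\to x(0)$. Here ''almost every'' refers to Lebesgue measure on $\mathcal X^\circ$ in the coordinates $(x_{ia})_{i\in\mathcal N,\,1\le a\le m_i}$. -/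

import Mathlib

open MeasureTheory Filter Topology

noncomputable section

/-- Pure action profiles: player `i` has the actions `0, 1, …, m i`. -/
abbrev ActionProfile {ι : Type*} (m : ι → ℕ) : Type _ := (i : ι) → Fin (m i + 1)

/-- Families `(p i a)` indexed by players and their actions. They carry the mixed strategy
profiles (see `IsMixed`) as well as the score profiles. -/
abbrev Profile {ι : Type*} (m : ι → ℕ) : Type _ := (i : ι) → Fin (m i + 1) → ℝ

/-- `x` is a mixed strategy profile: every `x i` is a probability vector. -/
def IsMixed {ι : Type*} {m : ι → ℕ} (x : Profile m) : Prop :=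
  ∀ i, x i ∈ stdSimplex ℝ (Fin (m i + 1))

/-- `x` is a mixed strategy profile with full support, that is, a point of the relative interior
of the strategy space. -/
def IsInterior {ι : Type*} {m : ι → ℕ} (x : Profile m) : Prop :=
  IsMixed x ∧ ∀ i a, 0 < x i a

/-- The harmonic games: at every pure profile, the payoff differences over all unilateral
deviations of all players add up to zero. -/
def IsHarmonicGame {ι : Type*} [Fintype ι] [DecidableEq ι] {m : ι → ℕ}
    (u : ι → ActionProfile m → ℝ) : Prop :=
  ∀ α : ActionProfile m,
    ∑ i, ∑ b : Fin (m i + 1), (u i (Function.update α i b) - u i α) = 0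

/-- Expected payoff of player `i` when the players randomize independently according to `x`. -/
def mixedPayoff {ι : Type*} [Fintype ι] [DecidableEq ι] {m : ι → ℕ}
    (u : ι → ActionProfile m → ℝ) (i : ι) (x : Profile m) : ℝ :=
  ∑ α : ActionProfile m, u i α * ∏ j, x j (α j)

/-- Expected payoff of player `i` for the pure action `a` when the others play according
to `x`. -/
def payoffField {ι : Type*} [Fintype ι] [DecidableEq ι] {m : ι → ℕ}
    (u : ι → ActionProfile m → ℝ) (x : Profile m) (i : ι) (a : Fin (m i + 1)) : ℝ :=
  mixedPayoff u i (Function.update x i (Pi.single a 1))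

/-- The vector field of the replicator dynamics. -/
def replicatorField {ι : Type*} [Fintype ι] [DecidableEq ι] {m : ι → ℕ}
    (u : ι → ActionProfile m → ℝ) (x : Profile m) (i : ι) (a : Fin (m i + 1)) : ℝ :=
  x i a * (payoffField u x i a - mixedPayoff u i x)

/-- The logit choice map of all players. -/
def logitChoice {ι : Type*} {m : ι → ℕ} (y : Profile m) : Profile m :=
  fun i a => Real.exp (y i a) / ∑ b, Real.exp (y i b)

/-- `x` restricted to times `t ≥ 0` is a trajectory of the replicator dynamics (with a one-sided
derivative at time `0`). Its values at negative times are irrelevant. -/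
structure IsReplicatorTrajectory {ι : Type*} [Fintype ι] [DecidableEq ι] {m : ι → ℕ}
    (u : ι → ActionProfile m → ℝ) (x : ℝ → Profile m) : Prop where
  isMixed : ∀ t, 0 ≤ t → IsMixed (x t)
  hasDeriv : ∀ t, 0 ≤ t → ∀ i a,
    HasDerivWithinAt (fun s => x s i a) (replicatorField u (x t) i a) (Set.Ici 0) t

/-- `(y, x)` restricted to times `t ≥ 0` is a trajectory of the exponential-weights dynamics, with
scores `y` and mixed strategies `x`. Values at negative times are irrelevant. -/
structure IsEWTrajectory {ι : Type*} [Fintype ι] [DecidableEq ι] {m : ι → ℕ}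
    (u : ι → ActionProfile m → ℝ) (y x : ℝ → Profile m) : Prop where
  integrable : ∀ t, 0 ≤ t → ∀ i a,
    IntervalIntegrable (fun s => payoffField u (x s) i a) volume 0 t
  score_eq : ∀ t, 0 ≤ t → ∀ i a,
    y t i a = y 0 i a + ∫ s in (0 : ℝ)..t, payoffField u (x s) i a
  strategy_eq : ∀ t, 0 ≤ t → x t = logitChoice (y t)

/-- The path `x` returns to its starting point: `x (τ n) → x 0` along an increasing sequence
of nonnegative times `τ n → ∞`. -/
def IsRecurrentPath {ι : Type*} {m : ι → ℕ} (x : ℝ → Profile m) : Prop :=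
  ∃ τ : ℕ → ℝ, (∀ n, 0 ≤ τ n) ∧ StrictMono τ ∧ Tendsto τ atTop atTop ∧
    Tendsto (fun n => x (τ n)) atTop (𝓝 (x 0))

/-- The inverse of the chart that forgets the coordinate of action `0` of every player. It maps
`{z | ∀ i, (∀ k, 0 < z i k) ∧ ∑ k, z i k < 1}` bijectively onto the interior profiles. -/
def ofReduced {ι : Type*} {m : ι → ℕ} (z : (i : ι) → Fin (m i) → ℝ) : Profile m :=
  fun i => Fin.cons (1 - ∑ k, z i k) (z i)

/-- `P` holds for almost every interior strategy profile: in the coordinates that forget the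
action `0` of every player, the exceptional set of interior profiles is Lebesgue null. -/
def ForAlmostEveryInterior {ι : Type*} [Fintype ι] {m : ι → ℕ} (P : Profile m → Prop) : Prop :=
  ∀ᵐ z ∂(volume : Measure ((i : ι) → Fin (m i) → ℝ)),
    IsInterior (ofReduced z) → P (ofReduced z)

end

noncomputable section

/-! Let $z_{ia}=y_{ia}-y_{i0}$ for $a\ge1$. These score differences determine $x$ and solve an
autonomous ODE whose field is bounded and globally Lipschitz. Player $i$'s component depends only on
the other players' strategies, so the flow is divergence free and preserves volume
(`measurePreserving_timeOne`). Along it $\frac{d}{dt}\log x_{ia}=v_{ia}(x)-u_i(x)$, and harmonicity,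
extended multilinearly to mixed profiles, makes these derivatives add up to zero. So
$-\sum_{i,a}\log x_{ia}$ is conserved; it bounds $\|z\|$ (`norm_le_logBarrier`), so its sublevel
sets are invariant and of finite volume. Poincaré recurrence on them shows that almost every $z$ is
recurrent.

The Liouville step uses no Jacobian. Updating the players one at a time is a composition of shears,
each volume preserving by translation invariance; these compositions converge to the time-one map,
and volume preservation passes to the limit.

The differentiable map $z\mapsto x$ carries null sets to null sets (`forAlmostEveryInterior_of_ae`),
exponential weights induce replicator trajectories, and uniqueness for the replicator ODE extends
recurrence from one trajectory to all with the same start. -/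

/-! ### Global integral curves and the Euler step -/

open Set in
/-- A bounded, globally Lipschitz vector field has global integral curves. -/
theorem exists_forall_hasDerivAt_of_lipschitzWith {E : Type*} [NormedAddCommGroup E]
    [NormedSpace ℝ E] [CompleteSpace E] {f : E → E} {K L : NNReal} (hf : LipschitzWith K f)
    (hL : ∀ x, ‖f x‖ ≤ L) (x₀ : E) :
    ∃ z : ℝ → E, z 0 = x₀ ∧ ∀ t, HasDerivAt z (f (z t)) t := by
  have key : ∀ T : ℝ, 0 < T → ∃ z : ℝ → E, z 0 = x₀ ∧
      ∀ t ∈ Ioo (-T) T, HasDerivAt z (f (z t)) t := by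
    intro T hT
    have h0 : (0 : ℝ) ∈ Icc (-T) T := ⟨by linarith, hT.le⟩
    -- A curve of speed at most `L` stays in the ball of radius `L * T` up to time `T`, so every
    -- horizon `T` is admissible.
    have hP : IsPicardLindelof (fun _ => f) (⟨0, h0⟩ : Icc (-T) T) x₀ (L * T.toNNReal) 0 L K :=
      IsPicardLindelof.of_time_independent (fun x _ => hL x) hf.lipschitzOnWith (by
        simp [Real.coe_toNNReal T hT.le])
    obtain ⟨z, hz0, hz⟩ := hP.exists_eq_forall_mem_Icc_hasDerivWithinAt₀
    exact ⟨z, hz0, fun t ht => (hz t (Ioo_subset_Icc_self ht)).hasDerivAt (Icc_mem_nhds ht.1 ht.2)⟩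
  choose! γ hγ0 hγ using key
  have huniq : ∀ S T : ℝ, 0 < S → S ≤ T → EqOn (γ S) (γ T) (Ioo (-S) S) := by
    intro S T hS hST
    refine ODE_solution_unique_of_mem_Ioo (v := fun _ => f) (s := fun _ => univ) (K := K)
      (fun t _ => hf.lipschitzOnWith) (t₀ := 0) ⟨by linarith, hS⟩
      (fun t ht => ⟨hγ S hS t ht, trivial⟩) (fun t ht => ⟨hγ T (hS.trans_le hST) t
        ⟨by linarith [ht.1], by linarith [ht.2]⟩, trivial⟩) ?_
    rw [hγ0 S hS, hγ0 T (hS.trans_le hST)]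
  refine ⟨fun t => γ (|t| + 1) t, by simpa using hγ0 1 one_pos, fun t => ?_⟩
  have ht : t ∈ Ioo (-(|t| + 1)) (|t| + 1) :=
    ⟨by linarith [neg_abs_le t], by linarith [le_abs_self t]⟩
  refine (hγ (|t| + 1) (by positivity) t ht).congr_of_eventuallyEq ?_
  filter_upwards [Ioo_mem_nhds ht.1 ht.2] with s hs
  have hs' : s ∈ Ioo (-(|s| + 1)) (|s| + 1) :=
    ⟨by linarith [neg_abs_le s], by linarith [le_abs_self s]⟩
  rcases le_total (|s|) (|t|) with h | h
  · exact huniq _ _ (by positivity) (by linarith) hs'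
  · exact (huniq _ _ (by positivity) (by linarith) hs).symm

/-- Along an integral curve of a Lipschitz field bounded by `L`, one explicit Euler step has
quadratic error. -/
theorem norm_sub_euler_le {E : Type*} [NormedAddCommGroup E] [NormedSpace ℝ E] {f : E → E}
    {K L : NNReal} (hf : LipschitzWith K f) (hL : ∀ x, ‖f x‖ ≤ L) {z : ℝ → E}
    (hz : ∀ t, HasDerivAt z (f (z t)) t) {h : ℝ} (hh : 0 ≤ h) (t : ℝ) :
    ‖z (t + h) - z t - h • f (z t)‖ ≤ K * L * h ^ 2 := by
  have h1 : ∀ s, ‖z s - z t‖ ≤ L * ‖s - t‖ := fun s =>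
    convex_univ.norm_image_sub_le_of_norm_hasDerivWithin_le
      (fun x _ => (hz x).hasDerivWithinAt) (fun x _ => hL _) (Set.mem_univ _) (Set.mem_univ _)
  -- Subtracting the tangent line leaves a curve with derivative `f (z s) - f (z t)`, of norm at
  -- most `K * L * h`.
  have h2 : ‖(z (t + h) - (t + h) • f (z t)) - (z t - t • f (z t))‖ ≤
      K * (L * h) * ‖(t + h) - t‖ := by
    refine (convex_Icc t (t + h)).norm_image_sub_le_of_norm_hasDerivWithin_le
      (f := fun s => z s - s • f (z t)) (f' := fun s => f (z s) - f (z t))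
      (fun s _ => ?_) (fun s hs => ?_) (by simp [hh]) (by simp [hh])
    · have := (hz s).sub ((hasDerivAt_id s).smul_const (f (z t)))
      rw [one_smul] at this
      exact this.hasDerivWithinAt
    · refine (hf.norm_sub_le _ _).trans ?_
      gcongr
      refine (h1 s).trans ?_
      gcongr
      rw [Real.norm_eq_abs, abs_of_nonneg (by linarith [hs.1])]
      linarith [hs.2]
  have h3 : z (t + h) - z t - h • f (z t) =
      (z (t + h) - (t + h) • f (z t)) - (z t - t • f (z t)) := by
    rw [add_smul]; abel
  rw [h3]
  refine h2.trans (le_of_eq ?_)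
  rw [add_sub_cancel_left, Real.norm_eq_abs, abs_of_nonneg hh]
  ring

/-! ### Splitting scheme and Liouville's theorem -/

section Splitting

variable {ι : Type*} [Fintype ι] [DecidableEq ι] {E : ι → Type*}
  [∀ i, NormedAddCommGroup (E i)] [∀ i, NormedSpace ℝ (E i)]

/-- Move the `i`-th component along the field `f` for time `h`, freezing the others. -/
def shear (f : (∀ i, E i) → ∀ i, E i) (h : ℝ) (i : ι) (z : ∀ i, E i) : ∀ i, E i :=
  Function.update z i (z i + h • f z i)

/-- Apply the shears of all components in `l`, the last one first. -/
def splitStep (f : (∀ i, E i) → ∀ i, E i) (h : ℝ) (l : List ι) (z : ∀ i, E i) : ∀ i, E i :=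
  l.foldr (shear f h) z

omit [Fintype ι] in
theorem splitStep_cons (f : (∀ i, E i) → ∀ i, E i) (h : ℝ) (i : ι) (l : List ι) (z : ∀ i, E i) :
    splitStep f h (i :: l) z = shear f h i (splitStep f h l z) := rfl

/-- Without repetitions each component moves at most once, by at most `L * h`. When its turn comes
it still has its initial value and the field has changed by at most `K * (L * h)`. -/
theorem splitStep_estimates {f : (∀ i, E i) → ∀ i, E i} {K L : NNReal} (hf : LipschitzWith K f)
    (hL : ∀ x, ‖f x‖ ≤ L) {h : ℝ} (hh : 0 ≤ h) (z : ∀ i, E i) (l : List ι) (hl : l.Nodup) :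
    ‖splitStep f h l z - z‖ ≤ L * h ∧ (∀ i ∉ l, splitStep f h l z i = z i) ∧
      ∀ i ∈ l, ‖splitStep f h l z i - z i - h • f z i‖ ≤ K * L * h ^ 2 := by
  induction l with
  | nil => simp [splitStep]; positivity
  | cons a l ih =>
    obtain ⟨ha, hl'⟩ := List.nodup_cons.1 hl
    obtain ⟨h1, h2, h3⟩ := ih hl'
    have hself : splitStep f h (a :: l) z a = z a + h • f (splitStep f h l z) a := by
      rw [splitStep_cons, shear, Function.update_self, h2 a ha]
    have hother : ∀ i, i ≠ a → splitStep f h (a :: l) z i = splitStep f h l z i := by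
      intro i hi
      rw [splitStep_cons, shear, Function.update_of_ne hi]
    refine ⟨?_, ?_, ?_⟩
    · refine (pi_norm_le_iff_of_nonneg (by positivity)).2 fun i => ?_
      rcases eq_or_ne i a with rfl | hi
      · rw [Pi.sub_apply, hself, add_sub_cancel_left, norm_smul, Real.norm_eq_abs,
          abs_of_nonneg hh, mul_comm]
        gcongr
        exact (norm_le_pi_norm _ i).trans (hL _)
      · rw [Pi.sub_apply, hother i hi]
        exact (norm_le_pi_norm (splitStep f h l z - z) i).trans h1
    · intro i hi
      rw [List.mem_cons, not_or] at hi
      rw [hother i hi.1, h2 i hi.2]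
    · intro i hi
      rcases eq_or_ne i a with rfl | hia
      · have : splitStep f h (i :: l) z i - z i - h • f z i =
            h • (f (splitStep f h l z) - f z) i := by
          rw [hself, Pi.sub_apply, smul_sub]; abel
        rw [this, norm_smul, Real.norm_eq_abs, abs_of_nonneg hh]
        calc h * ‖(f (splitStep f h l z) - f z) i‖
            ≤ h * (K * (L * h)) := by
              gcongr
              refine (norm_le_pi_norm _ i).trans ((hf.norm_sub_le _ _).trans ?_)
              gcongr
          _ = K * L * h ^ 2 := by ring
      · rw [hother i hia]
        exact h3 i ((List.mem_cons.1 hi).resolve_left hia)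

theorem norm_splitStep_sub_euler_le {f : (∀ i, E i) → ∀ i, E i} {K L : NNReal}
    (hf : LipschitzWith K f) (hL : ∀ x, ‖f x‖ ≤ L) {h : ℝ} (hh : 0 ≤ h) (z : ∀ i, E i) :
    ‖splitStep f h Finset.univ.toList z - z - h • f z‖ ≤ K * L * h ^ 2 := by
  refine (pi_norm_le_iff_of_nonneg (by positivity)).2 fun i => ?_
  exact (splitStep_estimates hf hL hh z _ (Finset.nodup_toList _)).2.2 i (by simp)

/-- The splitting scheme approximates integral curves. -/
theorem norm_sub_iterate_splitStep_le {f : (∀ i, E i) → ∀ i, E i} {K L : NNReal}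
    (hf : LipschitzWith K f) (hL : ∀ x, ‖f x‖ ≤ L) {z : ℝ → ∀ i, E i}
    (hz : ∀ t, HasDerivAt z (f (z t)) t) {h : ℝ} (hh : 0 ≤ h) (n : ℕ) :
    ‖z (n * h) - (splitStep f h Finset.univ.toList)^[n] (z 0)‖ ≤
      n * (2 * K * L * h ^ 2) * (1 + K * h) ^ n := by
  induction n with
  | zero => simp
  | succ n ih =>
    rw [Function.iterate_succ_apply']
    set w := (splitStep f h Finset.univ.toList)^[n] (z 0)
    set p := z (n * h)
    have h1 : ‖z (n * h + h) - p - h • f p‖ ≤ K * L * h ^ 2 := norm_sub_euler_le hf hL hz hh _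
    have h2 := norm_splitStep_sub_euler_le hf hL hh w
    have h3 : ‖h • (f p - f w)‖ ≤ K * h * ‖p - w‖ := by
      rw [norm_smul, Real.norm_eq_abs, abs_of_nonneg hh]
      calc h * ‖f p - f w‖ ≤ h * (K * ‖p - w‖) := by gcongr; exact hf.norm_sub_le _ _
        _ = K * h * ‖p - w‖ := by ring
    -- Two one-step errors, of the curve and of the scheme, plus the propagation of the earlier
    -- error.
    have hid : z ((n + 1 : ℕ) * h) - splitStep f h Finset.univ.toList w =
        (z (n * h + h) - p - h • f p) - (splitStep f h Finset.univ.toList w - w - h • f w) +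
          h • (f p - f w) + (p - w) := by
      have : ((n + 1 : ℕ) : ℝ) * h = n * h + h := by push_cast; ring
      rw [this, smul_sub]; abel
    rw [hid]
    have hpow : (1 : ℝ) ≤ (1 + K * h) ^ (n + 1) :=
      one_le_pow₀ (by have : 0 ≤ (K : ℝ) * h := by positivity
                      linarith)
    have hB : (0 : ℝ) ≤ 2 * K * L * h ^ 2 := by positivity
    calc _ ≤ K * L * h ^ 2 + K * L * h ^ 2 + K * h * ‖p - w‖ + ‖p - w‖ := by
            refine (norm_add_le _ _).trans (add_le_add_left ?_ _)
            refine (norm_add_le _ _).trans (add_le_add ?_ h3)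
            exact (norm_sub_le _ _).trans (add_le_add h1 h2)
      _ = 2 * K * L * h ^ 2 + (1 + K * h) * ‖p - w‖ := by ring
      _ ≤ 2 * K * L * h ^ 2 * (1 + K * h) ^ (n + 1) +
          (1 + K * h) * (n * (2 * K * L * h ^ 2) * (1 + K * h) ^ n) := by
            have := le_mul_of_one_le_right hB hpow
            gcongr
      _ = _ := by push_cast; ring

theorem norm_sub_iterate_splitStep_one_div_le {f : (∀ i, E i) → ∀ i, E i} {K L : NNReal}
    (hf : LipschitzWith K f) (hL : ∀ x, ‖f x‖ ≤ L) {z : ℝ → ∀ i, E i}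
    (hz : ∀ t, HasDerivAt z (f (z t)) t) (n : ℕ) :
    ‖z 1 - (splitStep f (1 / ((n + 1 : ℕ) : ℝ)) Finset.univ.toList)^[n + 1] (z 0)‖ ≤
      2 * K * L * Real.exp K * (1 / ((n + 1 : ℕ) : ℝ)) := by
  have hn : (0 : ℝ) < ((n + 1 : ℕ) : ℝ) := by positivity
  have h := norm_sub_iterate_splitStep_le hf hL hz (h := 1 / ((n + 1 : ℕ) : ℝ)) (by positivity)
    (n + 1)
  rw [mul_one_div_cancel hn.ne'] at h
  refine h.trans ?_
  have hexp : (1 + K * (1 / ((n + 1 : ℕ) : ℝ))) ^ (n + 1) ≤ Real.exp K := by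
    calc (1 + K * (1 / ((n + 1 : ℕ) : ℝ))) ^ (n + 1)
        ≤ Real.exp (K * (1 / ((n + 1 : ℕ) : ℝ))) ^ (n + 1) := by
          gcongr
          rw [add_comm]
          exact Real.add_one_le_exp _
      _ = Real.exp K := by
          rw [← Real.exp_nat_mul]
          congr 1
          field_simp
  calc _ ≤ ((n + 1 : ℕ) : ℝ) * (2 * K * L * (1 / ((n + 1 : ℕ) : ℝ)) ^ 2) * Real.exp K := by
        gcongr
    _ = _ := by field_simp

variable [∀ i, FiniteDimensional ℝ (E i)] [∀ i, MeasurableSpace (E i)] [∀ i, BorelSpace (E i)]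
  (μ : ∀ i, Measure (E i)) [∀ i, (μ i).IsAddHaarMeasure]

/-- With the other components frozen, the shear translates the `i`-th one by a constant vector,
because `f z i` ignores `z i`. Fubini and translation invariance conclude. -/
theorem measurePreserving_shear {f : (∀ i, E i) → ∀ i, E i} (hf : Continuous f)
    (hsplit : ∀ i z w, f (Function.update z i w) i = f z i) (h : ℝ) (i : ι) :
    MeasurePreserving (shear f h i) (Measure.pi μ) (Measure.pi μ) := by
  have hcont : Continuous (shear f h i) := by
    unfold shear
    exact continuous_id.update i (by fun_prop)
  refine ⟨hcont.measurable, Measure.ext_of_lintegral _ fun g hg => ?_⟩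
  rw [lintegral_map hg hcont.measurable]
  refine lintegral_eq_of_lmarginal_eq (f := fun z => g (shear f h i z)) {i}
    (hg.comp hcont.measurable) hg ?_
  rw [lmarginal_singleton, lmarginal_singleton]
  funext x
  have : ∀ y : E i, shear f h i (Function.update x i y) =
      Function.update x i (y + h • f x i) := by
    intro y
    simp [shear, hsplit]
  simp only [this]
  exact lintegral_add_right_eq_self (fun y => g (Function.update x i y)) (h • f x i)

theorem measurePreserving_splitStep {f : (∀ i, E i) → ∀ i, E i} (hf : Continuous f)
    (hsplit : ∀ i z w, f (Function.update z i w) i = f z i) (h : ℝ) (l : List ι) :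
    MeasurePreserving (splitStep f h l) (Measure.pi μ) (Measure.pi μ) := by
  induction l with
  | nil => exact MeasurePreserving.id _
  | cons a l ih => exact (measurePreserving_shear μ hf hsplit h a).comp ih

/-- A Liouville theorem: if each component of a Lipschitz bounded field does not depend on
the same component of the point, then the time-one map of its flow preserves volume. -/
theorem measurePreserving_timeOne {f : (∀ i, E i) → ∀ i, E i} {K L : NNReal}
    (hf : LipschitzWith K f) (hL : ∀ x, ‖f x‖ ≤ L)
    (hsplit : ∀ i z w, f (Function.update z i w) i = f z i) {φ : ((∀ i, E i)) → ∀ i, E i}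
    (hφ : ∀ z₀, ∃ z : ℝ → ∀ i, E i, z 0 = z₀ ∧ z 1 = φ z₀ ∧ ∀ t, HasDerivAt z (f (z t)) t) :
    MeasurePreserving φ (Measure.pi μ) (Measure.pi μ) := by
  let Φ : ℕ → (∀ i, E i) → ∀ i, E i := fun n =>
    (splitStep f (1 / ((n + 1 : ℕ) : ℝ)) Finset.univ.toList)^[n + 1]
  have hΦ : ∀ n, MeasurePreserving (Φ n) (Measure.pi μ) (Measure.pi μ) := fun n =>
    (measurePreserving_splitStep μ hf.continuous hsplit _ _).iterate _
  set C : ℝ := 2 * K * L * Real.exp K with hC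
  have hC0 : 0 ≤ C := by positivity
  have herr : ∀ n z, ‖φ z - Φ n z‖ ≤ C * (1 / ((n + 1 : ℕ) : ℝ)) := by
    intro n z₀
    obtain ⟨z, h0, h1, hz⟩ := hφ z₀
    rw [← h1, ← h0]
    exact norm_sub_iterate_splitStep_one_div_le hf hL hz n
  have hlim : ∀ z, Tendsto (fun n => Φ n z) atTop (𝓝 (φ z)) := by
    intro z
    rw [tendsto_iff_norm_sub_tendsto_zero]
    refine squeeze_zero (fun _ => norm_nonneg _) (fun n => (norm_sub_rev _ _).trans_le (herr n z)) ?_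
    have : Tendsto (fun n : ℕ => C * (1 / ((n : ℝ) + 1))) atTop (𝓝 (C * 0)) :=
      tendsto_one_div_add_atTop_nhds_zero_nat.const_mul C
    simpa using this
  have hmeas : Measurable φ :=
    measurable_of_tendsto_metrizable (fun n => (hΦ n).measurable) (tendsto_pi_nhds.2 hlim)
  have hφdist : ∀ z, ‖φ z - z‖ ≤ L := by
    intro z₀
    obtain ⟨z, h0, h1, hz⟩ := hφ z₀
    have := convex_univ.norm_image_sub_le_of_norm_hasDerivWithin_le (f := z)
      (fun x _ => (hz x).hasDerivWithinAt) (fun x _ => hL _) (Set.mem_univ 0) (Set.mem_univ 1)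
    simpa [h0, h1] using this
  -- This bound is uniform in `n`: all `g ∘ Φ n` below vanish outside one common ball, which yields
  -- the dominating function.
  have hΦdist : ∀ n z, ‖z‖ ≤ ‖Φ n z‖ + (C + L) := by
    intro n z
    have h1 : C * (1 / ((n + 1 : ℕ) : ℝ)) ≤ C := by
      refine mul_le_of_le_one_right hC0 ?_
      rw [div_le_one (by positivity)]
      push_cast
      linarith [(Nat.cast_nonneg n : (0 : ℝ) ≤ n)]
    have h2 : z = Φ n z + (φ z - Φ n z) - (φ z - z) := by abel
    calc ‖z‖ = ‖Φ n z + (φ z - Φ n z) - (φ z - z)‖ := by rw [← h2]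
      _ ≤ ‖Φ n z‖ + ‖φ z - Φ n z‖ + ‖φ z - z‖ :=
        (norm_sub_le _ _).trans (add_le_add_left (norm_add_le _ _) _)
      _ ≤ _ := by linarith [herr n z, hφdist z]
  refine ⟨hmeas, ?_⟩
  -- Local finiteness lets compactly supported continuous functions separate the two measures; it
  -- holds as `φ` moves points by at most `L`.
  have hfin : IsFiniteMeasureOnCompacts (Measure.map φ (Measure.pi μ)) := by
    refine ⟨fun k hk => ?_⟩
    obtain ⟨R, hR⟩ := hk.isBounded.subset_closedBall 0
    refine (measure_mono hR).trans_lt ?_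
    rw [Measure.map_apply hmeas Metric.isClosed_closedBall.measurableSet]
    refine (measure_mono (t := Metric.closedBall 0 (R + L)) fun z hz => ?_).trans_lt
      (isCompact_closedBall _ _).measure_lt_top
    simp only [Set.mem_preimage, mem_closedBall_zero_iff] at hz ⊢
    have h2 : z = φ z - (φ z - z) := by abel
    calc ‖z‖ = ‖φ z - (φ z - z)‖ := by rw [← h2]
      _ ≤ _ := (norm_sub_le _ _).trans (add_le_add hz (hφdist z))
  refine Measure.ext_of_integral_eq_on_compactlySupported fun g => ?_
  have hg : Continuous fun z => g z := g.continuous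
  rw [integral_map hmeas.aemeasurable hg.aestronglyMeasurable]
  obtain ⟨M, hM⟩ := g.hasCompactSupport.exists_bound_of_continuous g.continuous
  obtain ⟨R, hR⟩ := g.hasCompactSupport.isCompact.isBounded.subset_closedBall 0
  have h1 : Tendsto (fun n => ∫ z, g (Φ n z) ∂Measure.pi μ) atTop
      (𝓝 (∫ z, g (φ z) ∂Measure.pi μ)) := by
    refine tendsto_integral_of_dominated_convergence
      ((Metric.closedBall 0 (R + (C + L))).indicator fun _ => M)
      (fun n => (hg.measurable.comp (hΦ n).measurable).aestronglyMeasurable) ?_ ?_ ?_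
    · rw [integrable_indicator_iff Metric.isClosed_closedBall.measurableSet]
      exact integrableOn_const (isCompact_closedBall _ _).measure_lt_top.ne
    · intro n
      refine Eventually.of_forall fun z => ?_
      by_cases hz : z ∈ Metric.closedBall 0 (R + (C + L))
      · rw [Set.indicator_of_mem hz]
        exact hM _
      · rw [Set.indicator_of_notMem hz, norm_le_zero_iff]
        by_contra hne
        refine hz ?_
        have := hR (subset_tsupport _ (Function.mem_support.2 hne))
        rw [mem_closedBall_zero_iff] at this ⊢
        linarith [hΦdist n z]
    · exact Eventually.of_forall fun z => (hg.tendsto _).comp (hlim z)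
  have h2 : ∀ n, ∫ z, g (Φ n z) ∂Measure.pi μ = ∫ z, g z ∂Measure.pi μ := by
    intro n
    rw [← integral_map (hΦ n).measurable.aemeasurable (f := fun z => g z)
      hg.aestronglyMeasurable, (hΦ n).map_eq]
  simp_rw [h2] at h1
  exact tendsto_nhds_unique tendsto_const_nhds h1 |>.symm

end Splitting

theorem abs_prod_sub_prod_le {ι : Type*} (s : Finset ι) (a b : ι → ℝ) (ha : ∀ i, |a i| ≤ 1)
    (hb : ∀ i, |b i| ≤ 1) : |∏ i ∈ s, a i - ∏ i ∈ s, b i| ≤ ∑ i ∈ s, |a i - b i| := by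
  classical
  induction s using Finset.induction_on with
  | empty => simp
  | insert j s hj ih =>
    rw [Finset.prod_insert hj, Finset.prod_insert hj, Finset.sum_insert hj]
    have h1 : |∏ i ∈ s, a i| ≤ 1 := by
      rw [Finset.abs_prod]
      exact Finset.prod_le_one (fun _ _ => abs_nonneg _) fun i _ => ha i
    have h2 : a j * ∏ i ∈ s, a i - b j * ∏ i ∈ s, b i =
        (a j - b j) * ∏ i ∈ s, a i + b j * (∏ i ∈ s, a i - ∏ i ∈ s, b i) := by ring
    rw [h2]
    refine (abs_add_le _ _).trans (add_le_add ?_ ?_)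
    · rw [abs_mul]
      exact mul_le_of_le_one_right (abs_nonneg _) h1
    · rw [abs_mul]
      exact (mul_le_of_le_one_left (abs_nonneg _) (hb j)).trans ih

/-! ### The logit choice map -/

section Softmax

theorem IsMixed.le_one {ι : Type*} {m : ι → ℕ} {x : Profile m} (hx : IsMixed x) (i : ι)
    (a : Fin (m i + 1)) : x i a ≤ 1 :=
  (Finset.single_le_sum (f := x i) (fun b _ => (hx i).1 b) (Finset.mem_univ a)).trans_eq (hx i).2

theorem abs_apply_le_norm {ι : Type*} [Fintype ι] {κ : ι → Type*} [∀ i, Fintype (κ i)]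
    (x : ∀ i, κ i → ℝ) (i : ι) (a : κ i) : |x i a| ≤ ‖x‖ :=
  (norm_le_pi_norm (x i) a).trans (norm_le_pi_norm x i)

theorem norm_le_of_forall_abs_apply_le {ι : Type*} [Fintype ι] {κ : ι → Type*}
    [∀ i, Fintype (κ i)] {x : ∀ i, κ i → ℝ} {r : ℝ} (hr : 0 ≤ r)
    (h : ∀ i a, |x i a| ≤ r) : ‖x‖ ≤ r :=
  (pi_norm_le_iff_of_nonneg hr).2 fun i => (pi_norm_le_iff_of_nonneg hr).2 fun a => h i a

theorem IsMixed.norm_le_one {ι : Type*} [Fintype ι] {m : ι → ℕ} {x : Profile m}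
    (hx : IsMixed x) : ‖x‖ ≤ 1 :=
  norm_le_of_forall_abs_apply_le zero_le_one fun i a => by
    rw [abs_of_nonneg ((hx i).1 a)]
    exact hx.le_one i a

variable {ι : Type*} {m : ι → ℕ}

theorem sum_exp_pos (y : Profile m) (i : ι) : 0 < ∑ b, Real.exp (y i b) :=
  Finset.sum_pos (fun _ _ => Real.exp_pos _) Finset.univ_nonempty

theorem logitChoice_pos (y : Profile m) (i : ι) (a : Fin (m i + 1)) : 0 < logitChoice y i a :=
  div_pos (Real.exp_pos _) (sum_exp_pos y i)

theorem isMixed_logitChoice (y : Profile m) : IsMixed (logitChoice y) := fun i =>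
  ⟨fun a => (logitChoice_pos y i a).le, by
    simp only [logitChoice]
    rw [← Finset.sum_div, div_self (sum_exp_pos y i).ne']⟩

theorem logitChoice_log {x : Profile m} (hx : IsInterior x) :
    logitChoice (fun i a => Real.log (x i a)) = x := by
  funext i a
  have : ∀ b, Real.exp (Real.log (x i b)) = x i b := fun b => Real.exp_log (hx.2 i b)
  simp [logitChoice, this, (hx.1 i).2]

theorem log_logitChoice_sub (y : Profile m) (i : ι) (a b : Fin (m i + 1)) :
    Real.log (logitChoice y i a) - Real.log (logitChoice y i b) = y i a - y i b := by
  simp only [logitChoice]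
  rw [Real.log_div (Real.exp_ne_zero _) (sum_exp_pos y i).ne',
    Real.log_div (Real.exp_ne_zero _) (sum_exp_pos y i).ne', Real.log_exp, Real.log_exp]
  ring

theorem logitChoice_sub_const (y : Profile m) (c : ι → ℝ) :
    logitChoice (fun i a => y i a - c i) = logitChoice y := by
  funext i a
  simp only [logitChoice, Real.exp_sub]
  rw [← Finset.sum_div, div_div_div_cancel_right₀ (Real.exp_ne_zero _)]

/-- Numerator and denominator each change by a factor of at most `exp δ`; since probabilities are at
most one, `1 - exp (-(2 * δ)) ≤ 2 * δ` bounds the difference. -/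
theorem logitChoice_sub_le (y y' : Profile m) {δ : ℝ} (i : ι) (h : ∀ b, |y i b - y' i b| ≤ δ)
    (a : Fin (m i + 1)) : logitChoice y i a - logitChoice y' i a ≤ 2 * δ := by
  have hS : 0 < ∑ b, Real.exp (y i b) := sum_exp_pos y i
  have hS' : 0 < ∑ b, Real.exp (y' i b) := sum_exp_pos y' i
  have h1 : Real.exp (-δ) * Real.exp (y i a) ≤ Real.exp (y' i a) := by
    rw [← Real.exp_add, Real.exp_le_exp]
    linarith [(abs_le.1 (h a)).2]
  have h2 : ∑ b, Real.exp (y' i b) ≤ Real.exp δ * ∑ b, Real.exp (y i b) := by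
    rw [Finset.mul_sum]
    refine Finset.sum_le_sum fun b _ => ?_
    rw [← Real.exp_add, Real.exp_le_exp]
    linarith [(abs_le.1 (h b)).1]
  have h3 : Real.exp (-(2 * δ)) * logitChoice y i a ≤ logitChoice y' i a := by
    calc Real.exp (-(2 * δ)) * logitChoice y i a
        = Real.exp (-δ) * Real.exp (y i a) / (Real.exp δ * ∑ b, Real.exp (y i b)) := by
          have : Real.exp (-(2 * δ)) = Real.exp (-δ) / Real.exp δ := by
            rw [← Real.exp_sub]; ring_nf
          rw [this, logitChoice, div_mul_div_comm]
      _ ≤ Real.exp (y' i a) / ∑ b, Real.exp (y' i b) := by gcongr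
  have h4 := (isMixed_logitChoice y).le_one i a
  have h5 := logitChoice_pos y i a
  have h6 : 1 - 2 * δ ≤ Real.exp (-(2 * δ)) := Real.one_sub_le_exp_neg _
  have hδ : 0 ≤ δ := (abs_nonneg _).trans (h a)
  nlinarith

theorem norm_logitChoice_sub_le [Fintype ι] (y y' : Profile m) :
    ‖logitChoice y - logitChoice y'‖ ≤ 2 * ‖y - y'‖ := by
  refine norm_le_of_forall_abs_apply_le (by positivity) fun i a => abs_le.2 ⟨?_, ?_⟩
  · have := logitChoice_sub_le y' y i (δ := ‖y - y'‖)
      (fun b => by rw [abs_sub_comm]; exact abs_apply_le_norm (y - y') i b) a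
    simp only [Pi.sub_apply]
    linarith
  · exact logitChoice_sub_le y y' i (fun b => abs_apply_le_norm (y - y') i b) a

theorem continuous_logitChoice : Continuous (logitChoice : Profile m → Profile m) := by
  refine continuous_pi fun i => continuous_pi fun a => ?_
  have : ∀ y : Profile m, ∑ b, Real.exp (y i b) ≠ 0 := fun y => (sum_exp_pos y i).ne'
  simp only [logitChoice]
  fun_prop (disch := exact this _)

theorem hasDerivWithinAt_logitChoice {y : ℝ → Profile m} {S : Set ℝ} {t : ℝ} {i : ι}
    {w : Fin (m i + 1) → ℝ} (hy : ∀ a, HasDerivWithinAt (fun s => y s i a) (w a) S t)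
    (a : Fin (m i + 1)) :
    HasDerivWithinAt (fun s => logitChoice (y s) i a)
      (logitChoice (y t) i a * (w a - ∑ b, logitChoice (y t) i b * w b)) S t := by
  have hS := (sum_exp_pos (y t) i).ne'
  have h1 : ∀ b, HasDerivWithinAt (fun s => Real.exp (y s i b)) (Real.exp (y t i b) * w b) S t :=
    fun b => (hy b).exp
  have h2 : HasDerivWithinAt (fun s => ∑ b, Real.exp (y s i b))
      (∑ b, Real.exp (y t i b) * w b) S t := HasDerivWithinAt.fun_sum fun b _ => h1 b
  refine ((h1 a).div h2 hS).congr_deriv ?_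
  have h3 : ∑ b, logitChoice (y t) i b * w b =
      (∑ b, Real.exp (y t i b) * w b) / ∑ b, Real.exp (y t i b) := by
    rw [Finset.sum_div]
    refine Finset.sum_congr rfl fun b _ => ?_
    simp only [logitChoice]
    ring
  rw [h3]
  simp only [logitChoice]
  field_simp

end Softmax

/-! ### Multilinear payoffs and harmonicity -/

section Payoffs

variable {ι : Type*} [Fintype ι] [DecidableEq ι] {m : ι → ℕ} (u : ι → ActionProfile m → ℝ)

/-- The sum of the absolute values of all payoffs. -/
def payoffBound : ℝ := ∑ i, ∑ α, |u i α|

theorem payoffBound_nonneg : 0 ≤ payoffBound u :=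
  Finset.sum_nonneg fun _ _ => Finset.sum_nonneg fun _ _ => abs_nonneg _

theorem sum_abs_le_payoffBound (i : ι) : ∑ α, |u i α| ≤ payoffBound u :=
  Finset.single_le_sum (f := fun i => ∑ α, |u i α|)
    (fun _ _ => Finset.sum_nonneg fun _ _ => abs_nonneg _) (Finset.mem_univ i)

theorem abs_mixedPayoff_le (i : ι) {x : Profile m} (hx : ‖x‖ ≤ 1) :
    |mixedPayoff u i x| ≤ payoffBound u := by
  refine (Finset.abs_sum_le_sum_abs _ _).trans ((Finset.sum_le_sum fun α _ => ?_).trans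
    (sum_abs_le_payoffBound u i))
  rw [abs_mul, Finset.abs_prod]
  exact mul_le_of_le_one_right (abs_nonneg _)
    (Finset.prod_le_one (fun _ _ => abs_nonneg _) fun j _ => (abs_apply_le_norm x j _).trans hx)

theorem abs_mixedPayoff_sub_le (i : ι) {x y : Profile m} (hx : ‖x‖ ≤ 1) (hy : ‖y‖ ≤ 1) :
    |mixedPayoff u i x - mixedPayoff u i y| ≤ payoffBound u * Fintype.card ι * ‖x - y‖ := by
  rw [mixedPayoff, mixedPayoff, ← Finset.sum_sub_distrib]
  refine (Finset.abs_sum_le_sum_abs _ _).trans ?_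
  calc ∑ α, |u i α * ∏ j, x j (α j) - u i α * ∏ j, y j (α j)|
      ≤ ∑ α, |u i α| * (Fintype.card ι * ‖x - y‖) := by
        refine Finset.sum_le_sum fun α _ => ?_
        rw [← mul_sub, abs_mul]
        refine mul_le_mul_of_nonneg_left ?_ (abs_nonneg _)
        refine (abs_prod_sub_prod_le _ (fun j => x j (α j)) (fun j => y j (α j))
          (fun j => (abs_apply_le_norm x j _).trans hx)
          (fun j => (abs_apply_le_norm y j _).trans hy)).trans ?_
        refine (Finset.sum_le_sum (g := fun _ => ‖x - y‖)
          fun j _ => abs_apply_le_norm (x - y) j _).trans_eq ?_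
        simp [Finset.card_univ]
    _ = (∑ α, |u i α|) * (Fintype.card ι * ‖x - y‖) := by rw [Finset.sum_mul]
    _ ≤ payoffBound u * (Fintype.card ι * ‖x - y‖) := by
        gcongr
        exact sum_abs_le_payoffBound u i
    _ = _ := by ring

theorem norm_update_single_le_one (i : ι) (a : Fin (m i + 1)) {x : Profile m} (hx : ‖x‖ ≤ 1) :
    ‖Function.update x i (Pi.single a 1)‖ ≤ 1 := by
  refine norm_le_of_forall_abs_apply_le zero_le_one fun j b => ?_
  rcases eq_or_ne j i with rfl | hj
  · rw [Function.update_self]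
    rcases eq_or_ne b a with rfl | hb <;> simp [*]
  · rw [Function.update_of_ne hj]
    exact (abs_apply_le_norm x j b).trans hx

theorem norm_update_sub_update_le (i : ι) (c : Fin (m i + 1) → ℝ) (x y : Profile m) :
    ‖Function.update x i c - Function.update y i c‖ ≤ ‖x - y‖ := by
  refine norm_le_of_forall_abs_apply_le (norm_nonneg _) fun j b => ?_
  rcases eq_or_ne j i with rfl | hj
  · simp
  · simp only [Pi.sub_apply]
    rw [Function.update_of_ne hj, Function.update_of_ne hj]
    exact abs_apply_le_norm (x - y) j b

theorem abs_payoffField_le {x : Profile m} (hx : ‖x‖ ≤ 1) (i : ι) (a : Fin (m i + 1)) :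
    |payoffField u x i a| ≤ payoffBound u :=
  abs_mixedPayoff_le u i (norm_update_single_le_one i a hx)

theorem abs_payoffField_sub_le {x y : Profile m} (hx : ‖x‖ ≤ 1) (hy : ‖y‖ ≤ 1) (i : ι)
    (a : Fin (m i + 1)) :
    |payoffField u x i a - payoffField u y i a| ≤ payoffBound u * Fintype.card ι * ‖x - y‖ := by
  refine (abs_mixedPayoff_sub_le u i (norm_update_single_le_one i a hx)
    (norm_update_single_le_one i a hy)).trans ?_
  have := payoffBound_nonneg u
  gcongr
  exact norm_update_sub_update_le i _ x y

/-- The unit ball of the sup norm contains all mixed profiles, so a Lipschitz bound there suffices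
for uniqueness of trajectories. -/
theorem exists_lipschitzOnWith_replicatorField :
    ∃ K : NNReal, LipschitzOnWith K (replicatorField u) (Metric.closedBall 0 1) := by
  have hC := payoffBound_nonneg u
  refine ⟨⟨2 * payoffBound u + 2 * (payoffBound u * Fintype.card ι), by positivity⟩,
    LipschitzOnWith.of_dist_le_mul fun x hx y hy => ?_⟩
  rw [mem_closedBall_zero_iff] at hx hy
  rw [dist_eq_norm, dist_eq_norm]
  change _ ≤ (2 * payoffBound u + 2 * (payoffBound u * Fintype.card ι)) * ‖x - y‖
  refine norm_le_of_forall_abs_apply_le (by positivity) fun i a => ?_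
  have h1 := abs_apply_le_norm (x - y) i a
  have h2 := (abs_apply_le_norm y i a).trans hy
  have h3 := abs_payoffField_sub_le u hx hy i a
  have h4 := abs_mixedPayoff_sub_le u i hx hy
  have h5 := abs_payoffField_le u hx i a
  have h6 := abs_mixedPayoff_le u i hx
  have hid : (replicatorField u x - replicatorField u y) i a =
      (x i a - y i a) * (payoffField u x i a - mixedPayoff u i x) +
      y i a * ((payoffField u x i a - payoffField u y i a) -
        (mixedPayoff u i x - mixedPayoff u i y)) := by
    simp only [Pi.sub_apply, replicatorField]
    ring
  rw [hid]
  calc _ ≤ |x i a - y i a| * (|payoffField u x i a| + |mixedPayoff u i x|) +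
        |y i a| * (|payoffField u x i a - payoffField u y i a| +
          |mixedPayoff u i x - mixedPayoff u i y|) := by
        refine (abs_add_le _ _).trans (add_le_add ?_ ?_) <;> rw [abs_mul] <;> gcongr <;>
          exact abs_sub _ _
    _ ≤ ‖x - y‖ * (payoffBound u + payoffBound u) +
        1 * (payoffBound u * Fintype.card ι * ‖x - y‖ +
          payoffBound u * Fintype.card ι * ‖x - y‖) := by
        gcongr
        exact h1
    _ = _ := by ring

/-- The payoff field depends on the strategies of the other players only. -/
theorem payoffField_update (x : Profile m) (i : ι) (w : Fin (m i + 1) → ℝ) :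
    payoffField u (Function.update x i w) i = payoffField u x i := by
  funext a
  simp [payoffField]

/-- Linearity in player `i`'s strategy. The function `v` is arbitrary so that it may also be a
deviation payoff. -/
theorem mixedPayoff_update_eq_sum (v : ActionProfile m → ℝ) (x : Profile m) (i : ι)
    (p : Fin (m i + 1) → ℝ) :
    ∑ α, v α * ∏ j, Function.update x i p j (α j) =
      ∑ a, p a * ∑ α, v α * ∏ j, Function.update x i (Pi.single a 1) j (α j) := by
  have key : ∀ (q : Fin (m i + 1) → ℝ) (α : ActionProfile m),
      ∏ j, Function.update x i q j (α j) = q (α i) * ∏ j ∈ Finset.univ.erase i, x j (α j) := by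
    intro q α
    rw [← Finset.mul_prod_erase _ _ (Finset.mem_univ i), Function.update_self]
    congr 1
    refine Finset.prod_congr rfl fun j hj => ?_
    rw [Function.update_of_ne (Finset.ne_of_mem_erase hj)]
  simp_rw [key, Finset.mul_sum]
  rw [Finset.sum_comm]
  refine Finset.sum_congr rfl fun α _ => ?_
  rw [Finset.sum_eq_single (α i)]
  · simp; ring
  · intro b _ hb
    simp [Pi.single_eq_of_ne hb.symm]
  · simp

theorem sum_mul_payoffField (x : Profile m) (i : ι) :
    ∑ a, x i a * payoffField u x i a = mixedPayoff u i x := by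
  have := mixedPayoff_update_eq_sum (u i) x i (x i)
  rw [Function.update_eq_self] at this
  exact this.symm

/-- The deviation payoff ignores `α i`, so the weights `x i`, of total mass one, average out. -/
theorem sum_deviation_eq_payoffField {x : Profile m} (hx : IsMixed x) (i : ι)
    (b : Fin (m i + 1)) :
    ∑ α, u i (Function.update α i b) * ∏ j, x j (α j) = payoffField u x i b := by
  have h1 := mixedPayoff_update_eq_sum (fun α => u i (Function.update α i b)) x i (x i)
  rw [Function.update_eq_self] at h1
  rw [h1]
  have h2 : ∀ a, ∑ α : ActionProfile m, u i (Function.update α i b) *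
      ∏ j, Function.update x i (Pi.single a 1) j (α j) = payoffField u x i b := by
    intro a
    -- Swapping `a` and `b` for player `i` turns the point mass at `a` into the one at `b`.
    let e : ActionProfile m ≃ ActionProfile m :=
      Equiv.piCongrRight fun j => if h : j = i then h ▸ Equiv.swap a b else Equiv.refl _
    have hei : ∀ α, e α i = Equiv.swap a b (α i) := fun α => by simp [e]
    have hej : ∀ α j, j ≠ i → e α j = α j := fun α j hj => by simp [e, hj]
    rw [payoffField, mixedPayoff, eq_comm, ← Equiv.sum_comp e]
    refine Finset.sum_congr rfl fun α _ => ?_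
    symm
    have hprod : ∏ j, Function.update x i (Pi.single b 1) j (e α j) =
        ∏ j, Function.update x i (Pi.single a 1) j (α j) := by
      refine Finset.prod_congr rfl fun j _ => ?_
      rcases eq_or_ne j i with rfl | hj
      · rw [Function.update_self, Function.update_self, hei]
        rcases eq_or_ne (α j) a with h | h
        · rw [h, Equiv.swap_apply_left]; simp
        · rw [Pi.single_eq_of_ne h, Pi.single_eq_of_ne]
          rwa [ne_eq, Equiv.swap_apply_eq_iff, Equiv.swap_apply_right]
      · rw [Function.update_of_ne hj, Function.update_of_ne hj, hej α j hj]
    rw [hprod]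
    rcases eq_or_ne (α i) a with h | h
    · congr 2
      funext j
      rcases eq_or_ne j i with rfl | hj
      · rw [Function.update_self, hei, h, Equiv.swap_apply_left]
      · rw [Function.update_of_ne hj, hej α j hj]
    · have h0 : ∏ j, Function.update x i (Pi.single a 1) j (α j) = 0 := by
        refine Finset.prod_eq_zero (Finset.mem_univ i) ?_
        rw [Function.update_self, Pi.single_eq_of_ne h]
      rw [h0, mul_zero, mul_zero]
  simp_rw [h2]
  rw [← Finset.sum_mul, (hx i).2, one_mul]

/-- The multilinear form of harmonicity. -/
theorem IsHarmonicGame.sum_payoffField_sub_eq_zero {u : ι → ActionProfile m → ℝ}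
    (hu : IsHarmonicGame u) {x : Profile m} (hx : IsMixed x) :
    ∑ i, ∑ b, (payoffField u x i b - mixedPayoff u i x) = 0 := by
  have h1 : ∑ α : ActionProfile m,
      (∑ i, ∑ b, (u i (Function.update α i b) - u i α)) * ∏ j, x j (α j) = 0 :=
    Finset.sum_eq_zero fun α _ => by rw [hu α, zero_mul]
  rw [← h1]
  simp_rw [Finset.sum_mul]
  rw [Finset.sum_comm]
  refine Finset.sum_congr rfl fun i _ => ?_
  rw [Finset.sum_comm]
  refine Finset.sum_congr rfl fun b _ => ?_
  simp_rw [sub_mul]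
  rw [Finset.sum_sub_distrib, sum_deviation_eq_payoffField u hx, mixedPayoff]

end Payoffs

/-! ### Trajectories and the constant of motion -/

section Dynamics

variable {ι : Type*} [Fintype ι] [DecidableEq ι] {m : ι → ℕ} {u : ι → ActionProfile m → ℝ}

theorem IsReplicatorTrajectory.hasDerivWithinAt {x : ℝ → Profile m}
    (hx : IsReplicatorTrajectory u x) {t : ℝ} (ht : 0 ≤ t) :
    HasDerivWithinAt x (replicatorField u (x t)) (Set.Ici 0) t :=
  hasDerivWithinAt_pi.2 fun i => hasDerivWithinAt_pi.2 fun a => hx.hasDeriv t ht i a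

theorem IsReplicatorTrajectory.eqOn {x x' : ℝ → Profile m} (hx : IsReplicatorTrajectory u x)
    (hx' : IsReplicatorTrajectory u x') (h0 : x 0 = x' 0) {t : ℝ} (ht : 0 ≤ t) : x t = x' t := by
  obtain ⟨K, hK⟩ := exists_lipschitzOnWith_replicatorField u
  have hcont : ∀ {x : ℝ → Profile m}, IsReplicatorTrajectory u x →
      ContinuousOn x (Set.Icc 0 t) := fun h s hs =>
    (h.hasDerivWithinAt hs.1).continuousWithinAt.mono Set.Icc_subset_Ici_self
  have hder : ∀ {x : ℝ → Profile m}, IsReplicatorTrajectory u x → ∀ s ∈ Set.Ico 0 t,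
      HasDerivWithinAt x (replicatorField u (x s)) (Set.Ici s) s := fun h s hs =>
    (h.hasDerivWithinAt hs.1).mono (Set.Ici_subset_Ici.2 hs.1)
  have hmem : ∀ {x : ℝ → Profile m}, IsReplicatorTrajectory u x → ∀ s ∈ Set.Ico 0 t,
      x s ∈ Metric.closedBall (0 : Profile m) 1 := fun h s hs =>
    mem_closedBall_zero_iff.2 (h.isMixed s hs.1).norm_le_one
  exact ODE_solution_unique_of_mem_Icc_right (v := fun _ => replicatorField u) (fun _ _ => hK)
    (hcont hx) (hder hx) (hmem hx) (hcont hx') (hder hx') (hmem hx') h0 ⟨ht, le_rfl⟩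

theorem IsReplicatorTrajectory.congr {x x' : ℝ → Profile m} (hx : IsReplicatorTrajectory u x)
    (h : ∀ t, 0 ≤ t → x' t = x t) : IsReplicatorTrajectory u x' where
  isMixed t ht := by rw [h t ht]; exact hx.isMixed t ht
  hasDeriv t ht i a := by
    rw [h t ht]
    exact (hx.hasDeriv t ht i a).congr (fun s hs => by rw [h s hs]) (by rw [h t ht])

omit [Fintype ι] [DecidableEq ι] in
theorem IsRecurrentPath.congr {x x' : ℝ → Profile m} (hx : IsRecurrentPath x)
    (h : ∀ t, 0 ≤ t → x' t = x t) : IsRecurrentPath x' := by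
  obtain ⟨τ, h0, h1, h2, h3⟩ := hx
  refine ⟨τ, h0, h1, h2, ?_⟩
  rw [h 0 le_rfl]
  simpa only [h _ (h0 _)] using h3

/-- Scores that grow like the payoffs, up to a common term for each player, induce
replicator trajectories. -/
theorem isReplicatorTrajectory_logitChoice {y : ℝ → Profile m} (c : ℝ → ι → ℝ)
    (hy : ∀ t, 0 ≤ t → ∀ i a, HasDerivWithinAt (fun s => y s i a)
      (payoffField u (logitChoice (y t)) i a - c t i) (Set.Ici 0) t) :
    IsReplicatorTrajectory u (fun t => logitChoice (y t)) where
  isMixed t _ := isMixed_logitChoice _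
  hasDeriv t ht i a := by
    refine (hasDerivWithinAt_logitChoice (hy t ht i) a).congr_deriv ?_
    rw [replicatorField, ← sum_mul_payoffField]
    simp_rw [mul_sub]
    rw [Finset.sum_sub_distrib, ← Finset.sum_mul, (isMixed_logitChoice (y t) i).2]
    ring

variable (u) in
/-- The vector field of the scores in the exponential-weights dynamics. -/
def scoreField (y : Profile m) : Profile m := payoffField u (logitChoice y)

theorem abs_scoreField_le (y : Profile m) (i : ι) (a : Fin (m i + 1)) :
    |scoreField u y i a| ≤ payoffBound u :=
  abs_payoffField_le u (isMixed_logitChoice y).norm_le_one i a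

theorem abs_scoreField_sub_le (y y' : Profile m) (i : ι) (a : Fin (m i + 1)) :
    |scoreField u y i a - scoreField u y' i a| ≤
      2 * (payoffBound u * Fintype.card ι) * ‖y - y'‖ := by
  have := payoffBound_nonneg u
  calc _ ≤ payoffBound u * Fintype.card ι * ‖logitChoice y - logitChoice y'‖ :=
        abs_payoffField_sub_le u (isMixed_logitChoice y).norm_le_one
          (isMixed_logitChoice y').norm_le_one i a
    _ ≤ payoffBound u * Fintype.card ι * (2 * ‖y - y'‖) := by
        gcongr
        exact norm_logitChoice_sub_le y y'
    _ = _ := by ring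

theorem exists_lipschitzWith_scoreField :
    ∃ K L : NNReal, LipschitzWith K (scoreField u) ∧ ∀ y, ‖scoreField u y‖ ≤ L := by
  have hC := payoffBound_nonneg u
  refine ⟨⟨2 * (payoffBound u * Fintype.card ι), by positivity⟩, ⟨payoffBound u, hC⟩,
    LipschitzWith.of_dist_le_mul fun y y' => ?_,
    fun y => norm_le_of_forall_abs_apply_le hC (abs_scoreField_le y)⟩
  rw [dist_eq_norm, dist_eq_norm]
  exact norm_le_of_forall_abs_apply_le (mul_nonneg (NNReal.coe_nonneg _) (norm_nonneg _))
    (abs_scoreField_sub_le y y')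

theorem continuous_scoreField : Continuous (scoreField u) := by
  obtain ⟨K, L, hK, -⟩ := exists_lipschitzWith_scoreField (u := u)
  exact hK.continuous

theorem exists_isEWTrajectory (y₀ : Profile m) :
    ∃ y x : ℝ → Profile m, IsEWTrajectory u y x ∧ y 0 = y₀ := by
  obtain ⟨K, L, hK, hL⟩ := exists_lipschitzWith_scoreField (u := u)
  obtain ⟨y, hy0, hy⟩ := exists_forall_hasDerivAt_of_lipschitzWith hK hL y₀
  have hcont : Continuous y := continuous_iff_continuousAt.2 fun t => (hy t).continuousAt
  have hint : ∀ (i : ι) (a : Fin (m i + 1)) (t : ℝ), IntervalIntegrable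
      (fun s => payoffField u (logitChoice (y s)) i a) volume 0 t := by
    intro i a t
    refine Continuous.intervalIntegrable ?_ _ _
    exact continuous_pi_iff.1 (continuous_pi_iff.1 (continuous_scoreField.comp hcont) i) a
  refine ⟨y, fun t => logitChoice (y t), ⟨fun t _ i a => hint i a t, fun t _ i a => ?_,
    fun _ _ => rfl⟩, hy0⟩
  rw [intervalIntegral.integral_eq_sub_of_hasDerivAt (f := fun s => y s i a)
    (f' := fun s => payoffField u (logitChoice (y s)) i a)
    (fun s _ => hasDerivAt_pi.1 (hasDerivAt_pi.1 (hy s) i) a) (hint i a t)]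
  ring

/-- Bootstrapping: integrable payoffs make the scores continuous, hence the strategies and payoffs
continuous, hence the scores differentiable. -/
theorem IsEWTrajectory.isReplicatorTrajectory {y x : ℝ → Profile m}
    (h : IsEWTrajectory u y x) : IsReplicatorTrajectory u x := by
  have hycont : ∀ (i : ι) (a : Fin (m i + 1)), ContinuousOn (fun t => y t i a) (Set.Ici 0) := by
    intro i a t ht
    have ht' : (0 : ℝ) ≤ t + 1 := by linarith [Set.mem_Ici.1 ht]
    have h1 := intervalIntegral.continuousOn_primitive_interval' (h.integrable (t + 1) ht' i a)
      Set.left_mem_uIcc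
    rw [Set.uIcc_of_le ht'] at h1
    have h2 := (h1 t ⟨ht, by linarith⟩).const_add (y 0 i a)
    have h3 : ContinuousWithinAt (fun s => y 0 i a + ∫ r in (0 : ℝ)..s, payoffField u (x r) i a)
        (Set.Ici 0) t := by
      refine h2.mono_of_mem_nhdsWithin ?_
      filter_upwards [self_mem_nhdsWithin, mem_nhdsWithin_of_mem_nhds (Iio_mem_nhds (lt_add_one t))]
        with s hs1 hs2 using ⟨hs1, le_of_lt hs2⟩
    exact h3.congr (fun s hs => h.score_eq s hs i a) (h.score_eq t ht i a)
  -- Freezing the scores at negative times gives a continuous curve on the whole line.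
  let y' : ℝ → Profile m := fun t => y (max t 0)
  have hy'cont : Continuous y' := by
    refine continuous_pi fun i => continuous_pi fun a => ?_
    exact (hycont i a).comp_continuous (by fun_prop) fun t => le_max_right t 0
  have hy' : ∀ t, 0 ≤ t → y' t = y t := fun t ht => by simp [y', ht]
  have hx : ∀ t, 0 ≤ t → x t = logitChoice (y' t) := fun t ht => by
    rw [hy' t ht, h.strategy_eq t ht]
  refine IsReplicatorTrajectory.congr ?_ hx
  refine isReplicatorTrajectory_logitChoice (fun _ _ => 0) fun t ht i a => ?_
  rw [sub_zero]
  have hc : Continuous fun s => scoreField u (y' s) i a :=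
    continuous_pi_iff.1 (continuous_pi_iff.1 (continuous_scoreField.comp hy'cont) i) a
  have hd := ((intervalIntegral.integral_hasDerivAt_right (hc.intervalIntegrable 0 t)
    (hc.stronglyMeasurableAtFilter _ _) hc.continuousAt).const_add (y 0 i a)).hasDerivWithinAt
      (s := Set.Ici 0)
  have heq : ∀ s ∈ Set.Ici (0 : ℝ), y' s i a =
      y 0 i a + ∫ r in (0 : ℝ)..s, scoreField u (y' r) i a := by
    intro s hs
    rw [hy' s hs, h.score_eq s hs]
    congr 1
    refine intervalIntegral.integral_congr fun r hr => ?_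
    rw [Set.uIcc_of_le hs] at hr
    simp only [scoreField, hx r hr.1]
  exact hd.congr heq (heq t ht)

theorem exists_isReplicatorTrajectory {x₀ : Profile m} (hx₀ : IsInterior x₀) :
    ∃ x : ℝ → Profile m, IsReplicatorTrajectory u x ∧ x 0 = x₀ := by
  obtain ⟨y, x, h, hy⟩ := exists_isEWTrajectory (u := u) fun i a => Real.log (x₀ i a)
  refine ⟨x, h.isReplicatorTrajectory, ?_⟩
  rw [h.strategy_eq 0 le_rfl, hy, logitChoice_log hx₀]

/-- In a harmonic game, the sum of all log-probabilities is a constant of motion. -/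
theorem IsReplicatorTrajectory.sum_log_eq (hu : IsHarmonicGame u) {x : ℝ → Profile m}
    (hx : IsReplicatorTrajectory u x) (hpos : ∀ t i a, 0 < x t i a) {t : ℝ} (ht : 0 ≤ t) :
    ∑ i, ∑ a, Real.log (x t i a) = ∑ i, ∑ a, Real.log (x 0 i a) := by
  have hder : ∀ s, 0 ≤ s → HasDerivWithinAt (fun s => ∑ i, ∑ a, Real.log (x s i a)) 0
      (Set.Ici 0) s := by
    intro s hs
    have h : HasDerivWithinAt (fun s => ∑ i, ∑ a, Real.log (x s i a))
        (∑ i, ∑ a, replicatorField u (x s) i a / x s i a) (Set.Ici 0) s :=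
      HasDerivWithinAt.fun_sum fun i _ => HasDerivWithinAt.fun_sum fun a _ =>
        (hx.hasDeriv s hs i a).log (hpos s i a).ne'
    refine h.congr_deriv ?_
    -- Each logarithm has derivative `payoffField - mixedPayoff`; harmonicity cancels the sum.
    rw [← hu.sum_payoffField_sub_eq_zero (hx.isMixed s hs)]
    refine Finset.sum_congr rfl fun i _ => Finset.sum_congr rfl fun a _ => ?_
    rw [replicatorField, mul_div_cancel_left₀ _ (hpos s i a).ne']
  exact constant_of_has_deriv_right_zero
    (fun s hs => (hder s hs.1).continuousWithinAt.mono Set.Icc_subset_Ici_self)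
    (fun s hs => (hder s hs.1).mono (Set.Ici_subset_Ici.2 hs.1)) t ⟨ht, le_rfl⟩

end Dynamics

/-! ### Score differences -/

section Reduced

variable {ι : Type*} {m : ι → ℕ}

/-- The score profile in which action `0` of every player has score `0`. -/
def liftScore (z : (i : ι) → Fin (m i) → ℝ) : Profile m := fun i => Fin.cons 0 (z i)

theorem liftScore_zero (z : (i : ι) → Fin (m i) → ℝ) (i : ι) : liftScore z i 0 = 0 := rfl

theorem liftScore_succ (z : (i : ι) → Fin (m i) → ℝ) (i : ι) (k : Fin (m i)) :
    liftScore z i k.succ = z i k := rfl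

theorem continuous_liftScore :
    Continuous (liftScore : ((i : ι) → Fin (m i) → ℝ) → Profile m) := by
  refine continuous_pi fun i => continuous_pi fun a => ?_
  refine Fin.cases ?_ (fun k => ?_) a
  · exact continuous_const
  · exact continuous_pi_iff.1 (continuous_pi_iff.1 continuous_id i) k

variable [Fintype ι]

theorem norm_liftScore_sub_le (z w : (i : ι) → Fin (m i) → ℝ) :
    ‖liftScore z - liftScore w‖ ≤ ‖z - w‖ := by
  refine norm_le_of_forall_abs_apply_le (norm_nonneg _) fun i a => ?_
  refine Fin.cases ?_ (fun k => ?_) a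
  · simp [liftScore_zero]
  · exact abs_apply_le_norm (z - w) i k

/-- The sum of all negative log-probabilities. -/
def logBarrier (z : (i : ι) → Fin (m i) → ℝ) : ℝ :=
  ∑ i, ∑ a, -Real.log (logitChoice (liftScore z) i a)

theorem continuous_logBarrier :
    Continuous (logBarrier : ((i : ι) → Fin (m i) → ℝ) → ℝ) := by
  refine continuous_finsetSum _ fun i _ => continuous_finsetSum _ fun a _ => ?_
  refine (Continuous.log ?_ fun z => (logitChoice_pos (liftScore z) i a).ne').neg
  exact continuous_pi_iff.1 (continuous_pi_iff.1
    (continuous_logitChoice.comp continuous_liftScore) i) a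

/-- Each `z i k` is a difference of two log-probabilities, both between `-logBarrier z` and `0`.
This confines sublevel sets to balls. -/
theorem norm_le_logBarrier (z : (i : ι) → Fin (m i) → ℝ) : ‖z‖ ≤ logBarrier z := by
  have h0 : ∀ i a, 0 ≤ -Real.log (logitChoice (liftScore z) i a) := fun i a =>
    neg_nonneg.2 (Real.log_nonpos (logitChoice_pos _ i a).le
      ((isMixed_logitChoice (liftScore z)).le_one i a))
  have h1 : ∀ i a, -Real.log (logitChoice (liftScore z) i a) ≤ logBarrier z := fun i a =>
    (Finset.single_le_sum (f := fun a => -Real.log (logitChoice (liftScore z) i a))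
      (fun a _ => h0 i a) (Finset.mem_univ a)).trans
    (Finset.single_le_sum (f := fun i => ∑ a, -Real.log (logitChoice (liftScore z) i a))
      (fun i _ => Finset.sum_nonneg fun a _ => h0 i a) (Finset.mem_univ i))
  refine norm_le_of_forall_abs_apply_le
    (Finset.sum_nonneg fun i _ => Finset.sum_nonneg fun a _ => h0 i a) fun i k => ?_
  have h2 := log_logitChoice_sub (liftScore z) i k.succ 0
  rw [liftScore_succ, liftScore_zero, sub_zero] at h2
  rw [← h2, abs_le]
  constructor <;> linarith [h0 i k.succ, h0 i 0, h1 i k.succ, h1 i 0]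

/-- The coordinates of the strategies chosen at the scores `z`. -/
def reducedChoice (z : (i : ι) → Fin (m i) → ℝ) : (i : ι) → Fin (m i) → ℝ :=
  fun i k => logitChoice (liftScore z) i k.succ

theorem differentiable_reducedChoice :
    Differentiable ℝ (reducedChoice : ((i : ι) → Fin (m i) → ℝ) → (i : ι) → Fin (m i) → ℝ) := by
  refine differentiable_pi.2 fun i => differentiable_pi.2 fun k => ?_
  have h0 : ∀ a, Differentiable ℝ fun z : (i : ι) → Fin (m i) → ℝ => liftScore z i a := by
    intro a
    refine Fin.cases ?_ (fun k => ?_) a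
    · exact differentiable_const _
    · exact differentiable_pi.1 (differentiable_pi.1 differentiable_id i) k
  have h1 : Differentiable ℝ fun z : (i : ι) → Fin (m i) → ℝ =>
      ∑ b, Real.exp (liftScore z i b) := Differentiable.fun_sum fun b _ => (h0 b).exp
  exact fun z => ((h0 k.succ).exp z).mul ((h1 z).inv (sum_exp_pos (liftScore z) i).ne')

omit [Fintype ι] in
/-- Every interior profile is the logit choice of suitable normalized scores. -/
theorem exists_logitChoice_liftScore_eq {x : Profile m} (hx : IsInterior x) :
    ∃ z : (i : ι) → Fin (m i) → ℝ, logitChoice (liftScore z) = x := by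
  refine ⟨fun i k => Real.log (x i k.succ) - Real.log (x i 0), ?_⟩
  conv_rhs => rw [← logitChoice_log hx, ← logitChoice_sub_const _ fun i => Real.log (x i 0)]
  congr 1
  funext i a
  refine Fin.cases ?_ (fun k => ?_) a
  · rw [liftScore_zero, sub_self]
  · rw [liftScore_succ]

variable [DecidableEq ι] (u : ι → ActionProfile m → ℝ)

/-- The vector field of the score differences to action `0`. -/
def reducedField (z : (i : ι) → Fin (m i) → ℝ) : (i : ι) → Fin (m i) → ℝ :=
  fun i k => scoreField u (liftScore z) i k.succ - scoreField u (liftScore z) i 0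

theorem exists_lipschitzWith_reducedField :
    ∃ K L : NNReal, LipschitzWith K (reducedField u) ∧ ∀ z, ‖reducedField u z‖ ≤ L := by
  have hC := payoffBound_nonneg u
  refine ⟨⟨4 * (payoffBound u * Fintype.card ι), by positivity⟩,
    ⟨2 * payoffBound u, by positivity⟩, LipschitzWith.of_dist_le_mul fun z w => ?_, fun z => ?_⟩
  · rw [dist_eq_norm, dist_eq_norm]
    refine norm_le_of_forall_abs_apply_le (mul_nonneg (NNReal.coe_nonneg _) (norm_nonneg _))
      fun i k => ?_
    have h1 := abs_scoreField_sub_le (u := u) (liftScore z) (liftScore w) i k.succ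
    have h2 := abs_scoreField_sub_le (u := u) (liftScore z) (liftScore w) i 0
    have h3 : 2 * (payoffBound u * Fintype.card ι) * ‖liftScore z - liftScore w‖ ≤
        2 * (payoffBound u * Fintype.card ι) * ‖z - w‖ := by
      gcongr
      exact norm_liftScore_sub_le z w
    change |(_ - _) - (_ - _)| ≤ 4 * (payoffBound u * Fintype.card ι) * ‖z - w‖
    rw [sub_sub_sub_comm]
    refine (abs_sub _ _).trans ?_
    linarith
  · refine norm_le_of_forall_abs_apply_le (NNReal.coe_nonneg _) fun i k => ?_
    change _ ≤ 2 * payoffBound u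
    refine (abs_sub _ _).trans ?_
    linarith [abs_scoreField_le (u := u) (liftScore z) i k.succ,
      abs_scoreField_le (u := u) (liftScore z) i 0]

/-- This is the vanishing divergence: changing `z i` alters only player `i`'s strategy, which player
`i`'s payoff field ignores. -/
theorem reducedField_update (i : ι) (z : (i : ι) → Fin (m i) → ℝ) (w : Fin (m i) → ℝ) :
    reducedField u (Function.update z i w) i = reducedField u z i := by
  have h : logitChoice (liftScore (Function.update z i w)) = Function.update
      (logitChoice (liftScore z)) i (logitChoice (liftScore (Function.update z i w)) i) := by
    funext j
    rcases eq_or_ne j i with rfl | hj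
    · rw [Function.update_self]
    · rw [Function.update_of_ne hj]
      funext a
      simp only [logitChoice, liftScore, Function.update_of_ne hj]
  funext k
  simp only [reducedField, scoreField]
  rw [h, payoffField_update]

variable {u}

/-- The subtracted score rate of action `0` is common to all actions of a player, so it does not
affect the strategies. -/
theorem isReplicatorTrajectory_liftScore {z : ℝ → (i : ι) → Fin (m i) → ℝ}
    (hz : ∀ t, HasDerivAt z (reducedField u (z t)) t) :
    IsReplicatorTrajectory u fun t => logitChoice (liftScore (z t)) := by
  refine isReplicatorTrajectory_logitChoice (fun t i => scoreField u (liftScore (z t)) i 0)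
    fun t _ i a => ?_
  refine Fin.cases ?_ (fun k => ?_) a
  · simpa [liftScore_zero, scoreField] using hasDerivWithinAt_const _ _ _
  · exact (hasDerivAt_pi.1 (hasDerivAt_pi.1 (hz t) i) k).hasDerivWithinAt

theorem logBarrier_eq (hu : IsHarmonicGame u) {z : ℝ → (i : ι) → Fin (m i) → ℝ}
    (hz : ∀ t, HasDerivAt z (reducedField u (z t)) t) {t : ℝ} (ht : 0 ≤ t) :
    logBarrier (z t) = logBarrier (z 0) := by
  simp only [logBarrier, Finset.sum_neg_distrib]
  rw [(isReplicatorTrajectory_liftScore hz).sum_log_eq hu (fun _ => logitChoice_pos _) ht]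

/-! ### Poincaré recurrence and transfer to strategies -/

omit [DecidableEq ι] in
theorem isRecurrentPath_of_frequently {φ : ((i : ι) → Fin (m i) → ℝ) → (i : ι) → Fin (m i) → ℝ}
    {z : ℝ → (i : ι) → Fin (m i) → ℝ} (hφ : ∀ n : ℕ, φ^[n] (z 0) = z n)
    (h : ∀ s ∈ 𝓝 (z 0), ∃ᶠ n in atTop, φ^[n] (z 0) ∈ s) :
    IsRecurrentPath fun t => logitChoice (liftScore (z t)) := by
  have hc : MapClusterPt (z 0) atTop fun n => φ^[n] (z 0) := mapClusterPt_iff_frequently.2 h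
  obtain ⟨ψ, hψ, hlim⟩ := MapClusterPt.tendsto_subseq hc
  refine ⟨fun n => ψ n, fun n => Nat.cast_nonneg _, fun a b hab => Nat.cast_lt.2 (hψ hab),
    tendsto_natCast_atTop_atTop.comp hψ.tendsto_atTop, ?_⟩
  have := ((continuous_logitChoice.comp continuous_liftScore).tendsto _).comp hlim
  simpa only [Function.comp_def, hφ] using this

/-- In a harmonic game, almost every score vector is the start of a recurrent path. -/
theorem IsHarmonicGame.ae_exists_isRecurrentPath (hu : IsHarmonicGame u) :
    ∀ᵐ z₀ : (i : ι) → Fin (m i) → ℝ, ∃ x : ℝ → Profile m, IsReplicatorTrajectory u x ∧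
      x 0 = logitChoice (liftScore z₀) ∧ IsRecurrentPath x := by
  obtain ⟨K, L, hK, hL⟩ := exists_lipschitzWith_reducedField u
  choose Z hZ0 hZ using exists_forall_hasDerivAt_of_lipschitzWith hK hL
  let φ : ((i : ι) → Fin (m i) → ℝ) → (i : ι) → Fin (m i) → ℝ := fun z => Z z 1
  have hφ : MeasurePreserving φ volume volume :=
    measurePreserving_timeOne (fun _ => volume) hK hL (reducedField_update u)
      fun z₀ => ⟨Z z₀, hZ0 z₀, rfl, hZ z₀⟩
  have hiter : ∀ z₀ (n : ℕ), φ^[n] z₀ = Z z₀ n := by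
    intro z₀ n
    induction n with
    | zero => simp [hZ0]
    | succ n ih =>
      rw [Function.iterate_succ_apply', ih]
      -- The field is autonomous, so uniqueness gives the flow property.
      have hshift : Z (Z z₀ n) = fun t => Z z₀ (n + t) :=
        ODE_solution_unique_univ (v := fun _ => reducedField u) (s := fun _ => Set.univ) (t₀ := 0)
          (fun _ => hK.lipschitzOnWith) (fun t => ⟨hZ _ t, trivial⟩)
          (fun t => ⟨(hZ z₀ (n + t)).comp_const_add (n : ℝ) t, trivial⟩) (by rw [hZ0, add_zero])
      change Z (Z z₀ n) 1 = _
      rw [hshift]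
      push_cast
      rfl
  have hinv : ∀ z, logBarrier (φ z) = logBarrier z := fun z => by
    rw [show φ z = Z z 1 from rfl, logBarrier_eq hu (hZ z) zero_le_one, hZ0]
  -- The whole space may have infinite volume, so recurrence is applied on invariant sublevel sets;
  -- countably many levels exhaust the space.
  have hrec : ∀ c : ℕ, ∀ᵐ z₀ : (i : ι) → Fin (m i) → ℝ, logBarrier z₀ ≤ c →
      ∀ s ∈ 𝓝 z₀, ∃ᶠ n in atTop, φ^[n] z₀ ∈ s := by
    intro c
    let S : Set ((i : ι) → Fin (m i) → ℝ) := {z | logBarrier z ≤ c}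
    have hS : MeasurableSet S :=
      (isClosed_le continuous_logBarrier continuous_const).measurableSet
    have hpre : φ ⁻¹' S = S := by
      ext z
      simp only [S, Set.mem_preimage, Set.mem_ofPred_eq, hinv]
    have hfin : IsFiniteMeasure (volume.restrict S) := by
      refine ⟨?_⟩
      rw [Measure.restrict_apply_univ]
      refine (measure_mono fun z hz => ?_).trans_lt
        (isCompact_closedBall (0 : (i : ι) → Fin (m i) → ℝ) c).measure_lt_top
      exact mem_closedBall_zero_iff.2 ((norm_le_logBarrier z).trans hz)
    have hres := hφ.restrict_preimage hS
    rw [hpre] at hres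
    exact (ae_restrict_iff' hS).1 hres.conservative.ae_frequently_mem_of_mem_nhds
  filter_upwards [ae_all_iff.2 hrec] with z₀ h
  obtain ⟨c, hc⟩ := exists_nat_ge (logBarrier z₀)
  refine ⟨fun t => logitChoice (liftScore (Z z₀ t)), isReplicatorTrajectory_liftScore (hZ z₀),
    congrArg (fun z => logitChoice (liftScore z)) (hZ0 z₀), isRecurrentPath_of_frequently (φ := φ) ?_ ?_⟩
  · rw [hZ0]
    exact hiter z₀
  · rw [hZ0]
    exact h c hc

omit [DecidableEq ι] in
-- A differentiable self-map of a finite-dimensional space sends null sets to null sets. Every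
-- exceptional interior profile is the image of an exceptional score vector.
theorem forAlmostEveryInterior_of_ae {P : Profile m → Prop}
    (h : ∀ᵐ z : (i : ι) → Fin (m i) → ℝ, P (logitChoice (liftScore z))) :
    ForAlmostEveryInterior P := by
  have h0 := addHaar_image_eq_zero_of_differentiableOn_of_addHaar_eq_zero volume
    (differentiable_reducedChoice (m := m)).differentiableOn (ae_iff.1 h)
  refine measure_mono_null (fun w hw => ?_) h0
  obtain ⟨hw1, hw2⟩ := Classical.not_imp.1 hw
  obtain ⟨z, hz⟩ := exists_logitChoice_liftScore_eq hw1
  refine ⟨z, by rwa [← hz] at hw2, ?_⟩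
  funext i k
  rw [reducedChoice, hz, ofReduced, Fin.cons_succ]

end Reduced

end

theorem mainTheorem3 {ι : Type*} [Fintype ι] [DecidableEq ι] (m : ι → ℕ)
    (u : ι → ActionProfile m → ℝ) (hu : IsHarmonicGame u) :
    (∀ x₀ : Profile m, IsInterior x₀ →
      ∃ x : ℝ → Profile m, IsReplicatorTrajectory u x ∧ x 0 = x₀) ∧
    (∀ y₀ : Profile m,
      ∃ y x : ℝ → Profile m, IsEWTrajectory u y x ∧ y 0 = y₀) ∧
    ForAlmostEveryInterior (fun x₀ : Profile m =>
      (∀ x : ℝ → Profile m, IsReplicatorTrajectory u x → x 0 = x₀ → IsRecurrentPath x) ∧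
      (∀ y x : ℝ → Profile m, IsEWTrajectory u y x → x 0 = x₀ → IsRecurrentPath x)) := by
  refine ⟨fun x₀ => exists_isReplicatorTrajectory, exists_isEWTrajectory, ?_⟩
  refine forAlmostEveryInterior_of_ae ?_
  filter_upwards [hu.ae_exists_isRecurrentPath] with z ⟨x', hx', h0', hrec⟩
  have key : ∀ x : ℝ → Profile m, IsReplicatorTrajectory u x →
      x 0 = logitChoice (liftScore z) → IsRecurrentPath x := fun x hx h0 =>
    hrec.congr fun t ht => hx.eqOn hx' (h0.trans h0'.symm) ht
  exact ⟨key, fun y x h h0 => key x h.isReplicatorTrajectory h0⟩
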